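/- All graphs are finite and simple; the null graph (no vertices) is allowed and counts as a path. A graph $X$ is a fan if it is a path or has a vertex whose removal leaves a path. A graph $H$ is a minor of $G$ if there are pairwise disjoint sets $B_x\subseteq V(G)$ $(x\in V(H))$, each inducing a non-empty connected subgraph of $G$, such that for every edge $xy$ of $H$ some edge of $G$ joins $B_x$ to $B_y$; otherwise $G$ is $H$-minor-free. An elimination forest of $G$ is a rooted forest $F$ with $V(F)=V(G)$ such that for every edge $uv$ of $G$ one of $u,v$ lies on the path in $F$ from a root to the other. A layering of $G$ is a sequence $\mathcal L=(L_i\mid i\ge 0)$ of pairwise disjoint subsets of $V(G)$ with union $V(G)$ such that for every edge $uv$ of $G$ there is $i\ge 0$ with $u,v\in L_i\cup L_{i+1}$. The width of $(F,\mathcal L)$ is the maximum of $|V(R)\cap L_i|$ over all root-to-leaf paths $R$ in $F$ and all $i\ge 0$ (and $0$ if $G$ is null). The layered treedepth $\operatorname{ltd}(G)$ is the minimum width of $(F,\mathcal L)$ over all elimination forests $F$ and layerings $\mathcal L$ of $G$. **Theorem.** For every fan $X$ with at least three vertices and every graph $G$, if $G$ is $X$-minor-free, then $$\operatorname{ltd}(G)\le\binom{|V(X)|-1}{2}.$$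 -/

import Mathlib

namespace LayeredTreedepth

variable {V W : Type*}

/-- `G` is a (finite) path graph; the null graph counts as a path. -/
def IsPathGraph (G : SimpleGraph V) : Prop :=
  ∃ n : ℕ, Nonempty (G ≃g SimpleGraph.pathGraph n)

/-- `X` is a fan: it becomes a path by the removal of at most one vertex. -/
def IsFan (X : SimpleGraph W) : Prop :=
  IsPathGraph X ∨ ∃ x : W, IsPathGraph (X.induce ({x}ᶜ : Set W))

/-- The family `B` of branch sets is a model of `H` in `G`. Mathlib's `Connected` includes
non-emptiness. -/
structure IsModel (H : SimpleGraph W) (G : SimpleGraph V) (B : W → Set V) : Prop where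
  disjoint : Pairwise fun x y => Disjoint (B x) (B y)
  connected : ∀ x, (G.induce (B x)).Connected
  adj : ∀ x y, H.Adj x y → ∃ u ∈ B x, ∃ v ∈ B y, G.Adj u v

/-- `H` is a minor of `G`. -/
def IsMinor (H : SimpleGraph W) (G : SimpleGraph V) : Prop :=
  ∃ B : W → Set V, IsModel H G B

/-- `G` is `H`-minor-free. -/
def MinorFree (H : SimpleGraph W) (G : SimpleGraph V) : Prop :=
  ¬ IsMinor H G

/-- A rooted forest with vertex set `V`, given by its parent map: `parent v = none` means that `v`
is a root, and `parent v = some u` means that `v` is a child of `u`. Well-foundedness says that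
following parents from any vertex reaches a root (in particular there are no cycles). -/
structure RootedForest (V : Type*) where
  parent : V → Option V
  wf : WellFounded fun u v : V => parent v = some u

namespace RootedForest

/-- `v` is a descendant of `u`: `u` is obtained from `v` by following parents zero or more times,
i.e. `u` lies on the path from a root to `v`. -/
def IsDescendant (F : RootedForest V) (v u : V) : Prop :=
  Relation.ReflTransGen (fun a b => F.parent a = some b) v u

/-- The vertex set of the path from the root of the component of `v` to `v`. -/
def rootPath (F : RootedForest V) (v : V) : Set V :=
  {u | F.IsDescendant v u}

/-- A leaf is a vertex without children. -/
def IsLeaf (F : RootedForest V) (v : V) : Prop :=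
  ∀ u, F.parent u ≠ some v

/-- The closure of a rooted forest. -/
def closure (F : RootedForest V) : SimpleGraph V where
  Adj v w := v ≠ w ∧ (F.IsDescendant v w ∨ F.IsDescendant w v)
  symm := ⟨fun _ _ h => ⟨h.1.symm, h.2.symm⟩⟩
  loopless := ⟨fun _ h => h.1 rfl⟩

/-- `F` is an elimination forest of `G`. -/
def IsEliminationForest (F : RootedForest V) (G : SimpleGraph V) : Prop :=
  G ≤ F.closure

end RootedForest

/-- `(L i | i ≥ 0)` is a layering of `G`. -/
structure IsLayering (G : SimpleGraph V) (L : ℕ → Set V) : Prop where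
  disjoint : Pairwise fun i j => Disjoint (L i) (L j)
  iUnion_eq : ⋃ i, L i = Set.univ
  adj : ∀ u v, G.Adj u v → ∃ i, u ∈ L i ∪ L (i + 1) ∧ v ∈ L i ∪ L (i + 1)

/-- The width of `(F, L)`: the maximum of `|R ∩ L i|` over the root-to-leaf paths `R` of `F` and
`i ≥ 0` (taken in `ℕ∞`, where it is `0` for the null graph). -/
noncomputable def width (F : RootedForest V) (L : ℕ → Set V) : ℕ∞ :=
  ⨆ (v : V) (_ : F.IsLeaf v) (i : ℕ), (F.rootPath v ∩ L i).encard

/-- The layered treedepth of `G`: the minimum width of a pair `(F, L)` of an elimination forest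
and a layering of `G`. -/
noncomputable def ltd (G : SimpleGraph V) : ℕ∞ :=
  ⨅ (F : RootedForest V) (_ : F.IsEliminationForest G) (L : ℕ → Set V) (_ : IsLayering G L),
    width F L

end LayeredTreedepth

namespace LayeredTreedepth

variable {V W : Type*}

/-- `u` and `v` are joined by a walk of `G` all of whose vertices lie in `A` (or `u = v`). -/
def ReachIn (G : SimpleGraph V) (A : Set V) : V → V → Prop :=
  Relation.ReflTransGen fun a b => G.Adj a b ∧ a ∈ A ∧ b ∈ A

namespace ReachIn

variable {G : SimpleGraph V} {A B : Set V} {u v w : V}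

theorem refl (u : V) : ReachIn G A u u := Relation.ReflTransGen.refl

theorem trans (h : ReachIn G A u v) (h' : ReachIn G A v w) : ReachIn G A u w :=
  Relation.ReflTransGen.trans h h'

theorem symm (h : ReachIn G A u v) : ReachIn G A v u := by
  induction h with
  | refl => exact refl _
  | tail _ h ih => exact (Relation.ReflTransGen.single ⟨h.1.symm, h.2.2, h.2.1⟩).trans ih

theorem of_adj (h : G.Adj u v) (hu : u ∈ A) (hv : v ∈ A) : ReachIn G A u v :=
  Relation.ReflTransGen.single ⟨h, hu, hv⟩

theorem mono (hAB : A ⊆ B) (h : ReachIn G A u v) : ReachIn G B u v :=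
  Relation.ReflTransGen.mono (fun _ _ h => ⟨h.1, hAB h.2.1, hAB h.2.2⟩) _ _ h

theorem mem_right (h : ReachIn G A u v) (hu : u ∈ A) : v ∈ A := by
  induction h with
  | refl => exact hu
  | tail _ h _ => exact h.2.2

/-- A predicate that holds at `u` and is inherited along edges inside `A` holds at every vertex
reached from `u`. -/
theorem induct {p : V → Prop} (h : ReachIn G A u v) (hu : p u)
    (step : ∀ a b, G.Adj a b → a ∈ A → b ∈ A → p a → p b) : p v := by
  induction h with
  | refl => exact hu
  | tail _ h ih => exact step _ _ h.1 h.2.1 h.2.2 ih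

/-- A walk inside `A` that starts in a set `B` closed under neighbours in `A` stays in `B`. -/
theorem restrict (h : ReachIn G A u v) (hu : u ∈ B)
    (step : ∀ a b, G.Adj a b → a ∈ A → b ∈ A → a ∈ B → b ∈ B) : v ∈ B ∧ ReachIn G B u v := by
  refine h.induct (p := fun v => v ∈ B ∧ ReachIn G B u v) ⟨hu, refl _⟩ ?_
  rintro a b hab ha hb ⟨haB, hr⟩
  have := step a b hab ha hb haB
  exact ⟨this, hr.trans (of_adj hab haB this)⟩

theorem of_reachable (h : G.Reachable u v) : ReachIn G Set.univ u v := by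
  obtain ⟨p⟩ := h
  induction p with
  | nil => exact refl _
  | cons h _ ih => exact (of_adj h (Set.mem_univ _) (Set.mem_univ _)).trans ih

theorem reachable (h : ReachIn G A u v) (hu : u ∈ A) :
    (G.induce A).Reachable ⟨u, hu⟩ ⟨v, h.mem_right hu⟩ := by
  induction h with
  | refl => exact SimpleGraph.Reachable.refl _
  | tail h h' ih =>
    refine ih.trans (SimpleGraph.Adj.reachable ?_)
    exact h'.1

end ReachIn

theorem connected_of_reachIn {G : SimpleGraph V} {A : Set V} {x : V} (hx : x ∈ A)
    (h : ∀ v ∈ A, ReachIn G A x v) : (G.induce A).Connected := by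
  have : Nonempty A := ⟨⟨x, hx⟩⟩
  refine SimpleGraph.Connected.mk ?_
  rintro ⟨u, hu⟩ ⟨v, hv⟩
  exact ((h u hu).reachable hx).symm.trans ((h v hv).reachable hx)

/-! ### Elimination forests from rankings -/

/-- `u` precedes `v` in the elimination order given by the ranking `ρ`. -/
def Precedes (G : SimpleGraph V) (ρ : V → ℕ) (u v : V) : Prop :=
  ReachIn G {w | ρ u ≤ ρ w} u v

namespace Precedes

variable {G : SimpleGraph V} {ρ : V → ℕ} {u v w : V}

theorem le (h : Precedes G ρ u v) : ρ u ≤ ρ v :=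
  ReachIn.mem_right (A := {w | ρ u ≤ ρ w}) h (Nat.le_refl (ρ u))

theorem trans (h : Precedes G ρ u v) (h' : Precedes G ρ v w) : Precedes G ρ u w :=
  ReachIn.trans h (ReachIn.mono (fun _ hx => h.le.trans hx) h')

theorem of_le (h : Precedes G ρ u w) (h' : Precedes G ρ v w) (huv : ρ u ≤ ρ v) :
    Precedes G ρ u v :=
  ReachIn.trans h (ReachIn.mono (fun _ hx => huv.trans hx) (ReachIn.symm h'))

end Precedes

theorem exists_parent [Finite V] (G : SimpleGraph V) (ρ : V → ℕ) (v : V) :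
    ∃ o : Option V, (∀ p, o = some p → p ≠ v ∧ Precedes G ρ p v) ∧
      ∀ u, u ≠ v → Precedes G ρ u v → ∃ p, o = some p ∧ ρ u ≤ ρ p := by
  by_cases hne : ({u | u ≠ v ∧ Precedes G ρ u v} : Set V).Nonempty
  · obtain ⟨p, hp, hmax⟩ := Set.exists_max_image _ ρ (Set.toFinite _) hne
    exact ⟨some p, fun q hq => by cases hq; exact hp, fun u hu h => ⟨p, rfl, hmax u ⟨hu, h⟩⟩⟩
  · exact ⟨none, by simp, fun u hu h => (hne ⟨u, hu, h⟩).elim⟩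

theorem exists_forest_of_injective [Finite V] (G : SimpleGraph V) (ρ : V → ℕ)
    (hρ : Function.Injective ρ) :
    ∃ F : RootedForest V, F.IsEliminationForest G ∧
      ∀ v u, F.IsDescendant v u → Precedes G ρ u v := by
  choose f hf hf' using exists_parent G ρ
  have hlt : ∀ u v, f v = some u → ρ u < ρ v := fun u v h =>
    lt_of_le_of_ne (hf v u h).2.le fun h' => (hf v u h).1 (hρ h')
  let F : RootedForest V :=
    ⟨f, Subrelation.wf (fun {a b} h => hlt a b h) (InvImage.wf ρ Nat.lt_wfRel.wf)⟩
  have hdesc : ∀ n u v, ρ v = n → Precedes G ρ u v → F.IsDescendant v u := by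
    intro n
    induction n using Nat.strong_induction_on with
    | _ n ih =>
      intro u v hv h
      by_cases huv : u = v
      · subst huv; exact Relation.ReflTransGen.refl
      · obtain ⟨p, hp, hle⟩ := hf' v u huv h
        exact Relation.ReflTransGen.head hp
          (ih (ρ p) (hv ▸ hlt p v hp) u p rfl (h.of_le (hf v p hp).2 hle))
  refine ⟨F, ?_, ?_⟩
  · intro u v huv
    refine ⟨huv.ne, ?_⟩
    rcases le_total (ρ u) (ρ v) with h | h
    · exact Or.inr (hdesc _ u v rfl (ReachIn.of_adj huv (Nat.le_refl (ρ _)) h))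
    · exact Or.inl (hdesc _ v u rfl (ReachIn.of_adj huv.symm (Nat.le_refl (ρ _)) h))
  · intro v u h
    induction h with
    | refl => exact ReachIn.refl _
    | tail _ h ih => exact (hf _ _ h).2.trans ih

theorem ltd_le_of_ranking [Finite V] (G : SimpleGraph V) (ρ L : V → ℕ) (k : ℕ)
    (hL : ∀ u v, G.Adj u v → L u ≤ L v + 1)
    (hk : ∀ v i, {u | L u = i ∧ Precedes G ρ u v}.ncard ≤ k) : ltd G ≤ k := by
  obtain ⟨n, ⟨e⟩⟩ := Finite.exists_equiv_fin V
  have hlex : ∀ u v, ρ u * n + e u ≤ ρ v * n + e v → ρ u ≤ ρ v := by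
    intro u v h
    by_contra! hlt
    have h1 : (ρ v + 1) * n ≤ ρ u * n := Nat.mul_le_mul_right n hlt
    have h2 := (e v).2
    rw [add_mul, one_mul] at h1
    omega
  obtain ⟨F, hF, hd⟩ := exists_forest_of_injective G (fun v => ρ v * n + e v) (by
    intro u v h
    have h1 : ρ u = ρ v := le_antisymm (hlex u v h.le) (hlex v u h.ge)
    simp only [h1] at h
    exact e.injective (Fin.ext (by omega)))
  have hlay : IsLayering G fun i => {v | L v = i} := by
    refine ⟨fun i j hij => ?_, ?_, fun u v h => ?_⟩
    · exact Set.disjoint_left.2 fun v hv hv' => hij (hv.symm.trans hv')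
    · exact Set.eq_univ_of_forall fun v => Set.mem_iUnion.2 ⟨L v, rfl⟩
    · have h1 := hL u v h
      have h2 := hL v u h.symm
      refine ⟨min (L u) (L v), ?_, ?_⟩ <;> simp only [Set.mem_union, Set.mem_ofPred_eq] <;> omega
  refine (iInf₂_le_of_le F hF (iInf₂_le_of_le _ hlay ?_))
  refine iSup₂_le fun v _ => iSup_le fun i => ?_
  refine (Set.encard_le_encard (t := {u | L u = i ∧ Precedes G ρ u v}) ?_).trans ?_
  · rintro u ⟨hu, hi⟩
    exact ⟨hi, ReachIn.mono (fun w hw => hlex _ _ hw) (hd v u hu)⟩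
  · rw [← (Set.toFinite _).cast_ncard_eq]
    exact_mod_cast hk v i

/-! ### Rankings of vertex sets -/

/-- The set `C` has a ranking and a layering, with the vertices that have a neighbour outside `C` in
the first layer, whose elimination order has at most `k` vertices of each layer below any vertex. -/
def HasRanking (G : SimpleGraph V) (k : ℕ) (C : Set V) : Prop :=
  ∃ ρ L : V → ℕ, (∀ u ∈ C, ∀ v ∈ C, G.Adj u v → L u ≤ L v + 1) ∧
    (∀ u ∈ C, ∀ b ∉ C, G.Adj u b → L u = 0) ∧
    ∀ v ∈ C, ∀ i, {u ∈ C | L u = i ∧ ReachIn G {w ∈ C | ρ u ≤ ρ w} u v}.ncard ≤ k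

theorem comp_eq {G : SimpleGraph V} {A : Set V} {u v : V} (h : ReachIn G A u v) :
    {x | ReachIn G A u x} = {x | ReachIn G A v x} := by
  ext x
  exact ⟨h.symm.trans, h.trans⟩

/-- Rankings of the components of `C \ U` combine to a ranking of `C` whose first layer is `U`. -/
theorem hasRanking_of_components [Finite V] {G : SimpleGraph V} {k : ℕ} {C U : Set V} (d : V → ℕ)
    (hbd : ∀ u ∈ C, ∀ b ∉ C, G.Adj u b → u ∈ U)
    (hd : ∀ v ∈ C, {u ∈ U | ReachIn G {w ∈ C | w ∈ U → d u ≤ d w} u v}.ncard ≤ k)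
    (hcomp : ∀ w ∈ C \ U, HasRanking G k {v | ReachIn G (C \ U) w v}) : HasRanking G k C := by
  classical
  have hex : ∀ D : Set V, ∃ ρ L : V → ℕ, (∃ w ∈ C \ U, D = {v | ReachIn G (C \ U) w v}) →
      (∀ u ∈ D, ∀ v ∈ D, G.Adj u v → L u ≤ L v + 1) ∧
      (∀ u ∈ D, ∀ b ∉ D, G.Adj u b → L u = 0) ∧
      ∀ v ∈ D, ∀ i, {u ∈ D | L u = i ∧ ReachIn G {w ∈ D | ρ u ≤ ρ w} u v}.ncard ≤ k := by
    intro D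
    by_cases hD : ∃ w ∈ C \ U, D = {v | ReachIn G (C \ U) w v}
    · obtain ⟨w, hw, rfl⟩ := hD
      obtain ⟨ρ, L, h⟩ := hcomp w hw
      exact ⟨ρ, L, fun _ => h⟩
    · exact ⟨0, 0, fun h => (hD h).elim⟩
  choose f g hfg using hex
  obtain ⟨N, hN⟩ : ∃ N, ∀ v, d v < N := by
    obtain ⟨M, hM⟩ := (Set.finite_range d).bddAbove
    exact ⟨M + 1, fun v => Nat.lt_succ_of_le (hM ⟨v, rfl⟩)⟩
  let K : V → Set V := fun w => {v | ReachIn G (C \ U) w v}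
  have hK : ∀ w, w ∈ K w := fun w => ReachIn.refl w
  have hKeq : ∀ {u v}, ReachIn G (C \ U) u v → K u = K v := fun h => comp_eq h
  have hKsub : ∀ {w v}, w ∈ C \ U → v ∈ K w → v ∈ C \ U := fun hw hv =>
    ReachIn.mem_right hv hw
  have hprop : ∀ w ∈ C \ U, _ := fun w hw => hfg (K w) ⟨w, hw, rfl⟩
  let ρ : V → ℕ := fun w => if w ∈ U then d w else N + f (K w) w
  let L : V → ℕ := fun w => if w ∈ U then 0 else g (K w) w + 1
  have hρU : ∀ {w}, w ∈ U → ρ w = d w := fun h => if_pos h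
  have hρC : ∀ {w}, w ∉ U → ρ w = N + f (K w) w := fun h => if_neg h
  have hLU : ∀ {w}, w ∈ U → L w = 0 := fun h => if_pos h
  have hLC : ∀ {w}, w ∉ U → L w = g (K w) w + 1 := fun h => if_neg h
  refine ⟨ρ, L, ?_, fun u hu b hb h => hLU (hbd u hu b hb h), ?_⟩
  · intro u hu v hv huv
    by_cases huU : u ∈ U
    · rw [hLU huU]; exact Nat.zero_le _
    · rw [hLC huU]
      by_cases hvU : v ∈ U
      · rw [(hprop u ⟨hu, huU⟩).2.1 u (hK u) v (fun h => (hKsub ⟨hu, huU⟩ h).2 hvU) huv]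
        omega
      · have hr : ReachIn G (C \ U) u v := .of_adj huv ⟨hu, huU⟩ ⟨hv, hvU⟩
        rw [hLC hvU, ← hKeq hr]
        exact Nat.succ_le_succ ((hprop u ⟨hu, huU⟩).1 u (hK u) v hr huv)
  · intro v hv i
    rcases i with _ | i
    · refine (Set.ncard_le_ncard ?_ (Set.toFinite _)).trans (hd v hv)
      rintro u ⟨hu, hL, hr⟩
      have huU : u ∈ U := by
        by_contra h
        rw [hLC h] at hL
        omega
      refine ⟨huU, hr.mono ?_⟩
      rintro w ⟨hw, hle⟩
      refine ⟨hw, fun hwU => ?_⟩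
      rwa [hρU huU, hρU hwU] at hle
    · have key : ∀ u ∈ C, L u = i + 1 → ∀ w, ρ u ≤ ρ w → u ∉ U ∧ w ∉ U := by
        intro u _ hL w hle
        have huU : u ∉ U := fun h => by rw [hLU h] at hL; omega
        refine ⟨huU, fun h => ?_⟩
        rw [hρC huU, hρU h] at hle
        have := hN w
        omega
      by_cases hvU : v ∈ U
      · refine le_trans (le_of_eq ?_) (Nat.zero_le k)
        rw [Set.ncard_eq_zero (Set.toFinite _), Set.eq_empty_iff_forall_notMem]
        rintro u ⟨hu, hL, hr⟩
        exact (key u hu hL v (hr.mem_right ⟨hu, le_refl (ρ u)⟩).2).2 hvU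
      · refine (Set.ncard_le_ncard ?_ (Set.toFinite _)).trans
          ((hprop v ⟨hv, hvU⟩).2.2 v (hK v) i)
        rintro u ⟨hu, hL, hr⟩
        have hr' : ReachIn G (C \ U) u v :=
          hr.mono fun w hw => ⟨hw.1, (key u hu hL w hw.2).2⟩
        have huU := (key u hu hL u le_rfl).1
        have hL' := hL
        rw [hLC huU, hKeq hr'] at hL'
        refine ⟨hr'.symm, by omega, ?_⟩
        refine (hr.restrict (B := {w ∈ K v | f (K v) u ≤ f (K v) w}) ⟨hr'.symm, le_rfl⟩ ?_).2
        rintro a b hab ha hb ⟨haK, -⟩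
        have haU := (key u hu hL a ha.2).2
        have hbU := (key u hu hL b hb.2).2
        have hbK : ReachIn G (C \ U) v b :=
          ReachIn.trans haK (.of_adj hab ⟨ha.1, haU⟩ ⟨hb.1, hbU⟩)
        have hle := hb.2
        rw [hρC huU, hρC hbU, hKeq hr', ← hKeq hbK] at hle
        exact ⟨hbK, by omega⟩

/-! ### Vertex boundaries and tight closures -/

/-- The vertices of `A` with a neighbour outside `A`. -/
def innerBoundary (G : SimpleGraph V) (A : Set V) : Set V :=
  {a ∈ A | ∃ b, b ∉ A ∧ G.Adj a b}

theorem innerBoundary_of_subset {G : SimpleGraph V} {A B : Set V} (hAB : A ⊆ B) {z : V}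
    (hz : z ∈ innerBoundary G B) (hzA : z ∈ A) : z ∈ innerBoundary G A := by
  obtain ⟨-, b, hb, h⟩ := hz
  exact ⟨hzA, b, fun h' => hb (hAB h'), h⟩

theorem ncard_innerBoundary_submodular [Finite V] (G : SimpleGraph V) (A B : Set V) :
    (innerBoundary G (A ∪ B)).ncard + (innerBoundary G (A ∩ B)).ncard ≤
      (innerBoundary G A).ncard + (innerBoundary G B).ncard := by
  rw [← Set.ncard_union_add_ncard_inter (innerBoundary G (A ∪ B)),
    ← Set.ncard_union_add_ncard_inter (innerBoundary G A)]
  refine add_le_add (Set.ncard_le_ncard ?_ (Set.toFinite _))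
    (Set.ncard_le_ncard ?_ (Set.toFinite _))
  · rintro z (⟨hz | hz, b, hb, h⟩ | ⟨⟨hzA, hzB⟩, b, hb, h⟩)
    · exact Or.inl ⟨hz, b, fun h' => hb (Or.inl h'), h⟩
    · exact Or.inr ⟨hz, b, fun h' => hb (Or.inr h'), h⟩
    · by_cases hbA : b ∈ A
      · exact Or.inr ⟨hzB, b, fun h' => hb ⟨hbA, h'⟩, h⟩
      · exact Or.inl ⟨hzA, b, hbA, h⟩
  · rintro z ⟨⟨-, b, hb, h⟩, ⟨hzA, hzB⟩, -⟩
    exact ⟨⟨hzA, b, fun h' => hb (Or.inl h'), h⟩, ⟨hzB, b, fun h' => hb (Or.inr h'), h⟩⟩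

/-- `A` is the largest set between `Q` and `C` of minimum inner boundary. -/
structure IsTightClosure (G : SimpleGraph V) (C Q A : Set V) : Prop where
  subset : Q ⊆ A
  subset_univ : A ⊆ C
  min : ∀ B, Q ⊆ B → B ⊆ C → (innerBoundary G A).ncard ≤ (innerBoundary G B).ncard
  max : ∀ B, Q ⊆ B → B ⊆ C → (innerBoundary G B).ncard ≤ (innerBoundary G A).ncard → B ⊆ A

theorem exists_isTightClosure [Finite V] (G : SimpleGraph V) {C Q : Set V} (hQ : Q ⊆ C) :
    ∃ A, IsTightClosure G C Q A := by
  obtain ⟨A₀, hA₀, hmin⟩ := Set.exists_min_image {A : Set V | Q ⊆ A ∧ A ⊆ C}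
    (fun A => (innerBoundary G A).ncard) (Set.toFinite _) ⟨C, hQ, subset_rfl⟩
  obtain ⟨A, ⟨hA, hAle⟩, hmax⟩ := Set.exists_max_image
    {A : Set V | (Q ⊆ A ∧ A ⊆ C) ∧ (innerBoundary G A).ncard ≤ (innerBoundary G A₀).ncard}
    Set.ncard (Set.toFinite _) ⟨A₀, hA₀, le_rfl⟩
  refine ⟨A, hA.1, hA.2, fun B h1 h2 => hAle.trans (hmin B ⟨h1, h2⟩), fun B h1 h2 h3 => ?_⟩
  have hsub := ncard_innerBoundary_submodular G A B
  have hi := hmin (A ∩ B) ⟨Set.subset_inter hA.1 h1, Set.inter_subset_left.trans hA.2⟩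
  have hc := hmax (A ∪ B)
    ⟨⟨hA.1.trans Set.subset_union_left, Set.union_subset hA.2 h2⟩, by omega⟩
  have := Set.eq_of_subset_of_ncard_le (Set.subset_union_left (s := A) (t := B)) hc
    (Set.toFinite _)
  rw [this]
  exact Set.subset_union_right

namespace IsTightClosure

variable {G : SimpleGraph V} {C Q Q' A A' : Set V}

theorem mono [Finite V] (h : IsTightClosure G C Q A) (h' : IsTightClosure G C Q' A')
    (hQ : Q ⊆ Q') : A ⊆ A' := by
  have hsub := ncard_innerBoundary_submodular G A A'
  have hi := h.min (A ∩ A') (Set.subset_inter h.subset (hQ.trans h'.subset))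
    (Set.inter_subset_left.trans h.subset_univ)
  exact Set.subset_union_left.trans <| h'.max (A ∪ A') (h'.subset.trans Set.subset_union_right)
    (Set.union_subset h.subset_univ h'.subset_univ) (by omega)

theorem eq_of_ncard_eq [Finite V] (h : IsTightClosure G C Q A) (h' : IsTightClosure G C Q' A')
    (hQ : Q ⊆ Q') (he : (innerBoundary G A).ncard = (innerBoundary G A').ncard) : A = A' :=
  (h.mono h' hQ).antisymm (h.max A' (hQ.trans h'.subset) h'.subset_univ he.ge)

end IsTightClosure

/-- A union of sets that are determined by their cardinality, which is less than `n`. -/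
theorem ncard_iUnion_le_choose [Finite V] {ι : Type*} (I : Set ι) (Z : ι → Set V) (n : ℕ)
    (hlt : ∀ t ∈ I, (Z t).ncard < n)
    (heq : ∀ t ∈ I, ∀ t' ∈ I, (Z t).ncard = (Z t').ncard → Z t = Z t') :
    (⋃ t ∈ I, Z t).ncard ≤ n.choose 2 := by
  classical
  have hex : ∀ j : ℕ, ∃ Y : Set V, Y.ncard ≤ j ∧ ∀ t ∈ I, (Z t).ncard = j → Z t = Y := by
    intro j
    by_cases h : ∃ t ∈ I, (Z t).ncard = j
    · obtain ⟨t, ht, hj⟩ := h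
      exact ⟨Z t, hj.le, fun t' ht' hj' => heq t' ht' t ht (hj'.trans hj.symm)⟩
    · exact ⟨∅, by simp, fun t ht hj => (h ⟨t, ht, hj⟩).elim⟩
  choose Y hY hYZ using hex
  calc (⋃ t ∈ I, Z t).ncard ≤ (⋃ j ∈ Finset.range n, Y j).ncard := by
        refine Set.ncard_le_ncard ?_ (Set.toFinite _)
        refine Set.iUnion₂_subset fun t ht => ?_
        rw [hYZ _ t ht rfl]
        exact Set.subset_biUnion_of_mem (u := Y) (Finset.mem_coe.2 (Finset.mem_range.2 (hlt t ht)))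
    _ ≤ ∑ j ∈ Finset.range n, (Y j).ncard := Finset.set_ncard_biUnion_le _ _
    _ ≤ ∑ j ∈ Finset.range n, j := Finset.sum_le_sum fun j _ => hY j
    _ = n.choose 2 := by rw [Finset.sum_range_id, Nat.choose_two_right]

/-! ### Normal spanning forests -/

theorem reachIn_of_isChain {G : SimpleGraph V} {D : Set V} {l : List V} {v : V}
    (hc : (v :: l).IsChain G.Adj) (hD : ∀ t ∈ v :: l, t ∈ D) : ∀ t ∈ v :: l, ReachIn G D v t := by
  induction l generalizing v with
  | nil =>
    intro t ht
    rw [List.mem_singleton.1 ht]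
    exact .refl _
  | cons a l ih =>
    intro t ht
    rcases List.mem_cons.1 ht with rfl | ht
    · exact .refl _
    · rw [List.isChain_cons_cons] at hc
      exact (ReachIn.of_adj hc.1 (hD v (by simp)) (hD a (by simp))).trans
        (ih hc.2 (fun t ht => hD t (List.mem_cons_of_mem _ ht)) t ht)

/-- A normal spanning forest of `G[D]` with all its roots in `R`; `Q v` lists the vertices on the
path from `v` to its root. -/
structure IsNormalForest (G : SimpleGraph V) (D R : Set V) (Q : V → List V) : Prop where
  head : ∀ v ∈ D, ∃ l, Q v = v :: l
  mem : ∀ v ∈ D, ∀ t ∈ Q v, t ∈ D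
  chain : ∀ v ∈ D, (Q v).IsChain G.Adj
  nodup : ∀ v ∈ D, (Q v).Nodup
  last : ∀ v ∈ D, ∃ r ∈ R, (Q v).getLast? = some r
  suffix : ∀ v ∈ D, ∀ t ∈ Q v, Q t <:+ Q v
  adj : ∀ u ∈ D, ∀ v ∈ D, G.Adj u v → u ∈ Q v ∨ v ∈ Q u

namespace IsNormalForest

variable {G : SimpleGraph V} {D R : Set V} {Q : V → List V}

theorem self_mem (h : IsNormalForest G D R Q) {v : V} (hv : v ∈ D) : v ∈ Q v := by
  obtain ⟨l, hl⟩ := h.head v hv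
  simp [hl]

theorem reachIn (h : IsNormalForest G D R Q) {v t : V} (hv : v ∈ D) (ht : t ∈ Q v) :
    ReachIn G {w | w ∈ Q v} v t := by
  obtain ⟨l, hl⟩ := h.head v hv
  have hc := h.chain v hv
  rw [hl] at hc ht
  refine reachIn_of_isChain hc (fun t ht => ?_) t ht
  simpa [hl] using ht

theorem trans (h : IsNormalForest G D R Q) {u v w : V} (hw : w ∈ D) (huv : u ∈ Q v)
    (hvw : v ∈ Q w) : u ∈ Q w :=
  (h.suffix w hw v hvw).subset huv

theorem total (h : IsNormalForest G D R Q) {u v w : V} (hw : w ∈ D) (huw : u ∈ Q w)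
    (hvw : v ∈ Q w) : u ∈ Q v ∨ v ∈ Q u := by
  have hu := h.self_mem (h.mem w hw u huw)
  have hv := h.self_mem (h.mem w hw v hvw)
  rcases List.suffix_or_suffix_of_suffix (h.suffix w hw u huw) (h.suffix w hw v hvw) with h' | h'
  · exact Or.inl (h'.subset hu)
  · exact Or.inr (h'.subset hv)

theorem length_le (h : IsNormalForest G D R Q) {u v : V} (hv : v ∈ D) (huv : u ∈ Q v) :
    (Q u).length ≤ (Q v).length :=
  (h.suffix v hv u huv).length_le

theorem eq_of_length_le (h : IsNormalForest G D R Q) {u v : V} (hv : v ∈ D) (huv : u ∈ Q v)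
    (hle : (Q v).length ≤ (Q u).length) : u = v := by
  have he := (h.suffix v hv u huv).eq_of_length_le hle
  obtain ⟨l, hl⟩ := h.head v hv
  obtain ⟨l', hl'⟩ := h.head u (h.mem v hv u huv)
  rw [hl, hl'] at he
  exact (List.cons.inj he).1

theorem antisymm (h : IsNormalForest G D R Q) {u v : V} (hv : v ∈ D) (huv : u ∈ Q v)
    (hvu : v ∈ Q u) : u = v :=
  h.eq_of_length_le hv huv (h.length_le (h.mem v hv u huv) hvu)

/-- A connected set has a least vertex. -/
theorem exists_least [Finite V] (h : IsNormalForest G D R Q) {K : Set V} (hK : K ⊆ D)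
    {x : V} (hx : x ∈ K) (hconn : ∀ v ∈ K, ReachIn G K x v) :
    ∃ c ∈ K, ∀ v ∈ K, c ∈ Q v := by
  obtain ⟨c, hc, hmin⟩ := Set.exists_min_image K (fun v => (Q v).length) (Set.toFinite _) ⟨x, hx⟩
  refine ⟨c, hc, fun v hv => ?_⟩
  refine ((hconn c hc).symm.trans (hconn v hv)).induct (p := fun v => c ∈ Q v)
    (h.self_mem (hK hc)) ?_
  intro a b hab ha hb hca
  rcases h.adj a (hK ha) b (hK hb) hab with h1 | h1
  · exact h.trans (hK hb) hca h1
  · rcases h.total (hK ha) hca h1 with h2 | h2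
    · exact h2
    · rw [h.eq_of_length_le (hK hc) h2 (hmin b hb)]
      exact h.self_mem (hK hc)

end IsNormalForest

theorem exists_isNormalForest [Finite V] (G : SimpleGraph V) (n : ℕ) (D R : Set V)
    (hn : D.ncard = n) (hR : ∀ v ∈ D, ∃ r ∈ R, r ∈ D ∧ ReachIn G D v r) :
    ∃ Q, IsNormalForest G D R Q := by
  classical
  induction n generalizing D R with
  | zero =>
    rw [Set.ncard_eq_zero (Set.toFinite _)] at hn
    subst hn
    exact ⟨fun _ => [], by simp, by simp, by simp, by simp, by simp, by simp, by simp⟩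
  | succ n ih =>
    obtain ⟨v₀, hv₀⟩ : D.Nonempty := Set.nonempty_of_ncard_ne_zero (by omega)
    obtain ⟨r, hrR, hrD, -⟩ := hR v₀ hv₀
    obtain ⟨Q', h⟩ := ih (D \ {r}) {w | G.Adj w r ∨ (w ∈ R ∧ ¬ ReachIn G D r w)}
      (by rw [Set.ncard_sdiff_singleton_of_mem hrD]; omega) (by
        rintro v ⟨hv, hvr⟩
        by_cases hrv : ReachIn G D r v
        · have key : v ≠ r → ∃ w, G.Adj w r ∧ w ∈ D \ {r} ∧ ReachIn G (D \ {r}) v w := by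
            refine hrv.induct
              (p := fun v => v ≠ r → ∃ w, G.Adj w r ∧ w ∈ D \ {r} ∧ ReachIn G (D \ {r}) v w)
              (fun h => (h rfl).elim) ?_
            intro a b hab ha hb hp hbr
            by_cases har : a = r
            · subst har
              exact ⟨b, hab.symm, ⟨hb, hbr⟩, .refl _⟩
            · obtain ⟨w, hw, hwD, hr⟩ := hp har
              exact ⟨w, hw, hwD, (ReachIn.of_adj (A := D \ {r}) hab.symm ⟨hb, hbr⟩ ⟨ha, har⟩).trans hr⟩
          obtain ⟨w, hw, hwD, hr⟩ := key hvr
          exact ⟨w, Or.inl hw, hwD, hr⟩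
        · obtain ⟨w, hwR, hwD, hr⟩ := hR v hv
          have hrw : ¬ ReachIn G D r w := fun h => hrv (h.trans hr.symm)
          refine ⟨w, Or.inr ⟨hwR, hrw⟩, ⟨hwD, fun h => hrw (h ▸ .refl _)⟩, ?_⟩
          refine ((hr.restrict (B := {x ∈ D | ¬ ReachIn G D r x}) ⟨hv, hrv⟩ ?_).2).mono ?_
          · rintro a b hab ha hb ⟨-, hna⟩
            exact ⟨hb, fun h => hna (h.trans (.of_adj hab.symm hb ha))⟩
          · rintro x ⟨hx, hnx⟩
            exact ⟨hx, fun h => hnx (h ▸ .refl _)⟩)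
    have hreach : ∀ v ∈ D \ {r}, ∀ t ∈ Q' v, ReachIn G D v t := fun v hv t ht =>
      (h.reachIn hv ht).mono fun x hx => (h.mem v hv x hx).1
    let Q : V → List V := fun v =>
      if v = r then [r] else if ReachIn G D r v then Q' v ++ [r] else Q' v
    have hQr : Q r = [r] := if_pos rfl
    have hQ1 : ∀ {v}, v ≠ r → ReachIn G D r v → Q v = Q' v ++ [r] := fun hv h' => by
      simp only [Q, if_neg hv, if_pos h']
    have hQ2 : ∀ {v}, v ≠ r → ¬ ReachIn G D r v → Q v = Q' v := fun hv h' => by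
      simp only [Q, if_neg hv, if_neg h']
    have hcases : ∀ {p : V → Prop}, p r → (∀ v ∈ D \ {r}, ReachIn G D r v → p v) →
        (∀ v ∈ D \ {r}, ¬ ReachIn G D r v → p v) → ∀ v ∈ D, p v := by
      intro p h0 h1 h2 v hv
      by_cases hvr : v = r
      · exact hvr ▸ h0
      · by_cases h' : ReachIn G D r v
        · exact h1 v ⟨hv, hvr⟩ h'
        · exact h2 v ⟨hv, hvr⟩ h'
    have hlast : ∀ v ∈ D \ {r}, ReachIn G D r v → ∃ w, G.Adj w r ∧ (Q' v).getLast? = some w := by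
      intro v hv hrv
      obtain ⟨w, hw | hw, hl⟩ := h.last v hv
      · exact ⟨w, hw, hl⟩
      · exact (hw.2 (hrv.trans (hreach v hv w (List.mem_of_getLast? hl)))).elim
    refine ⟨Q, ?_, ?_, ?_, ?_, ?_, ?_, ?_⟩
    · refine hcases ⟨[], hQr⟩ (fun v hv h' => ?_) (fun v hv h' => ?_)
      · obtain ⟨l, hl⟩ := h.head v hv
        exact ⟨l ++ [r], by rw [hQ1 hv.2 h', hl]; rfl⟩
      · rw [hQ2 hv.2 h']
        exact h.head v hv
    · refine hcases (by simpa [hQr] using hrD) (fun v hv h' t ht => ?_) (fun v hv h' t ht => ?_)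
      · rw [hQ1 hv.2 h', List.mem_append, List.mem_singleton] at ht
        rcases ht with ht | rfl
        · exact (h.mem v hv t ht).1
        · exact hrD
      · rw [hQ2 hv.2 h'] at ht
        exact (h.mem v hv t ht).1
    · refine hcases (by simp [hQr]) (fun v hv h' => ?_) (fun v hv h' => ?_)
      · rw [hQ1 hv.2 h', List.isChain_append]
        refine ⟨h.chain v hv, by simp, fun x hx y hy => ?_⟩
        obtain ⟨w, hw, hl⟩ := hlast v hv h'
        simp only [hl, Option.mem_def, Option.some.injEq, List.head?_cons] at hx hy
        exact hx ▸ hy ▸ hw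
      · rw [hQ2 hv.2 h']
        exact h.chain v hv
    · refine hcases (by simp [hQr]) (fun v hv h' => ?_) (fun v hv h' => ?_)
      · rw [hQ1 hv.2 h', List.nodup_append]
        refine ⟨h.nodup v hv, by simp, fun a ha b hb hab => ?_⟩
        rw [List.mem_singleton.1 hb] at hab
        exact (h.mem v hv a ha).2 hab
      · rw [hQ2 hv.2 h']
        exact h.nodup v hv
    · refine hcases ⟨r, hrR, by simp [hQr]⟩ (fun v hv h' => ?_) (fun v hv h' => ?_)
      · exact ⟨r, hrR, by simp [hQ1 hv.2 h']⟩
      · rw [hQ2 hv.2 h']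
        obtain ⟨w, hw | hw, hl⟩ := h.last v hv
        · refine (h' (ReachIn.symm ?_)).elim
          have hwQ := List.mem_of_getLast? hl
          exact (hreach v hv w hwQ).trans (.of_adj hw (h.mem v hv w hwQ).1 hrD)
        · exact ⟨w, hw.1, hl⟩
    · refine hcases (by simp [hQr]) (fun v hv h' t ht => ?_) (fun v hv h' t ht => ?_)
      · rw [hQ1 hv.2 h'] at ht ⊢
        rcases List.mem_append.1 ht with ht | ht
        · rw [hQ1 (h.mem v hv t ht).2 (h'.trans (hreach v hv t ht))]
          obtain ⟨p, hp⟩ := h.suffix v hv t ht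
          exact ⟨p, by rw [← List.append_assoc, hp]⟩
        · rw [List.mem_singleton.1 ht, hQr]
          exact List.suffix_append _ _
      · rw [hQ2 hv.2 h'] at ht ⊢
        rw [hQ2 (h.mem v hv t ht).2 fun h'' => h' (h''.trans (hreach v hv t ht).symm)]
        exact h.suffix v hv t ht
    · intro u hu v hv huv
      have hQmem : ∀ {a b}, b ≠ r → a ∈ Q' b → a ∈ Q b := by
        intro a b hb hab
        by_cases h' : ReachIn G D r b
        · rw [hQ1 hb h']; exact List.mem_append_left _ hab
        · rwa [hQ2 hb h']
      by_cases hur : u = r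
      · subst hur
        left
        rw [hQ1 huv.ne' (.of_adj huv hu hv)]
        simp
      by_cases hvr : v = r
      · subst hvr
        right
        rw [hQ1 huv.ne (.of_adj huv.symm hv hu)]
        simp
      exact (h.adj u ⟨hu, hur⟩ v ⟨hv, hvr⟩ huv).imp (hQmem hvr) (hQmem hur)

/-! ### Disjoint connections to the boundary -/

/-- If every set between `Q` and `C` has at least `n` vertices in its inner boundary, then Hall's
theorem yields an injective partial map that moves vertices along edges, never into `Q`, and is
undefined only on the inner boundary of `C` and on `Q.card - n` further vertices. -/
theorem exists_injective_step [Fintype V] {G : SimpleGraph V} {C : Set V} {Q : Finset V} {n : ℕ}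
    (hQC : (Q : Set V) ⊆ C)
    (hn : ∀ A : Set V, (Q : Set V) ⊆ A → A ⊆ C → n ≤ (innerBoundary G A).ncard) :
    ∃ φ : {w // w ∈ C ∧ w ∉ innerBoundary G C} → V ⊕ Fin (Q.card - n), Function.Injective φ ∧
      ∀ w b, φ w = Sum.inl b → (b = w.1 ∨ G.Adj w.1 b) ∧ b ∉ Q := by
  classical
  let N : V → V → Prop := fun w b => b = w ∨ G.Adj w b
  let t : {w // w ∈ C ∧ w ∉ innerBoundary G C} → Finset (V ⊕ Fin (Q.card - n)) := fun w =>
    (Finset.univ.filter fun b => N w.1 b ∧ b ∉ Q).disjSum Finset.univ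
  have hall : ∀ s : Finset {w // w ∈ C ∧ w ∉ innerBoundary G C},
      s.card ≤ (s.biUnion t).card := by
    intro s
    rcases s.eq_empty_or_nonempty with rfl | ⟨w₀, hw₀⟩
    · simp
    let M : Finset V := Finset.univ.filter fun b => (∃ w ∈ s, N w.1 b) ∧ b ∉ Q
    have hsub : M.disjSum (Finset.univ : Finset (Fin (Q.card - n))) ⊆ s.biUnion t := by
      intro x hx
      rw [Finset.mem_biUnion]
      rcases Finset.mem_disjSum.1 hx with ⟨b, hb, rfl⟩ | ⟨i, -, rfl⟩
      · obtain ⟨⟨w, hw, hwb⟩, hbQ⟩ := (Finset.mem_filter.1 hb).2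
        exact ⟨w, hw, Finset.inl_mem_disjSum.2 (Finset.mem_filter.2 ⟨Finset.mem_univ _, hwb, hbQ⟩)⟩
      · exact ⟨w₀, hw₀, Finset.inr_mem_disjSum.2 (Finset.mem_univ _)⟩
    have hcard := Finset.card_le_card hsub
    rw [Finset.card_disjSum, Finset.card_univ, Fintype.card_fin] at hcard
    have hQ : n ≤ Q.card := by
      refine (hn Q subset_rfl hQC).trans ?_
      rw [← Set.ncard_coe_finset]
      exact Set.ncard_le_ncard (fun x hx => hx.1) (Set.toFinite _)
    let T : Finset V := s.map (Function.Embedding.subtype _)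
    have hTM : T ⊆ Q ∪ M := by
      intro x hx
      obtain ⟨w, hw, rfl⟩ := Finset.mem_map.1 hx
      by_cases hxQ : w.1 ∈ Q
      · exact Finset.mem_union_left _ hxQ
      · exact Finset.mem_union_right _
          (Finset.mem_filter.2 ⟨Finset.mem_univ _, ⟨w, hw, Or.inl rfl⟩, hxQ⟩)
    have hbd : innerBoundary G (Q ∪ M : Finset V) ⊆ ((Q ∪ M) \ T : Finset V) := by
      rintro x ⟨hx, b, hb, hxb⟩
      rw [Finset.coe_sdiff]
      refine ⟨hx, fun hxT => hb ?_⟩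
      obtain ⟨w, hw, rfl⟩ := Finset.mem_map.1 hxT
      rw [Finset.mem_coe, Finset.mem_union]
      by_cases hbQ : b ∈ Q
      · exact Or.inl hbQ
      · exact Or.inr (Finset.mem_filter.2 ⟨Finset.mem_univ _, ⟨w, hw, Or.inr hxb⟩, hbQ⟩)
    have h1 := hn (Q ∪ M : Finset V) (by simp) (by
      intro x hx
      rcases Finset.mem_union.1 hx with hx | hx
      · exact hQC hx
      · obtain ⟨⟨w, hw, rfl | hwx⟩, -⟩ := (Finset.mem_filter.1 hx).2
        · exact w.2.1
        · by_contra hxC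
          exact w.2.2 ⟨w.2.1, x, hxC, hwx⟩)
    have h2 := Set.ncard_le_ncard hbd (Set.toFinite _)
    rw [Set.ncard_coe_finset, Finset.card_sdiff_of_subset hTM, Finset.card_map] at h2
    have h3 := Finset.card_le_card hTM
    rw [Finset.card_map] at h3
    have h4 := Finset.card_union_le Q M
    omega
  obtain ⟨φ, hφ, hφt⟩ := (Finset.all_card_le_biUnion_card_iff_exists_injective t).1 hall
  refine ⟨φ, hφ, fun w b h => ?_⟩
  have := hφt w
  rw [h] at this
  exact (Finset.mem_filter.1 (Finset.inl_mem_disjSum.1 this)).2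

/-- A form of Menger's theorem: if every set between `Q` and `C` has at least `n` vertices in its
inner boundary, then `n` disjoint connected sets join `Q` to the inner boundary of `C`, each with
only one vertex in `Q`. -/
theorem exists_disjoint_connections [Fintype V] {G : SimpleGraph V} {C : Set V} {Q : Finset V}
    {n : ℕ} (hQC : (Q : Set V) ⊆ C)
    (hn : ∀ A : Set V, (Q : Set V) ⊆ A → A ⊆ C → n ≤ (innerBoundary G A).ncard) :
    ∃ (J : Finset V) (K : V → Set V), J ⊆ Q ∧ n ≤ J.card ∧
      ∀ j ∈ J, j ∈ K j ∧ K j ⊆ C ∧ (∀ v ∈ K j, ReachIn G (K j) j v) ∧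
        (∀ v ∈ K j, v ∈ Q → v = j) ∧ (∃ v ∈ K j, v ∈ innerBoundary G C) ∧
        ∀ i ∈ J, i ≠ j → Disjoint (K i) (K j) := by
  classical
  obtain ⟨φ, hφ, hφN⟩ := exists_injective_step hQC hn
  let r : V → V → Prop := fun a b => ∃ h, φ ⟨a, h⟩ = Sum.inl b
  let K : V → Set V := fun q => {v | Relation.ReflTransGen r q v}
  have hleft : ∀ {a a' b}, r a b → r a' b → a = a' := by
    rintro a a' b ⟨h, hb⟩ ⟨h', hb'⟩
    exact congrArg Subtype.val (hφ (hb.trans hb'.symm))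
  have hrQ : ∀ {a b}, r a b → b ∉ Q := fun ⟨h, hb⟩ => (hφN _ _ hb).2
  have hrC : ∀ {a b}, r a b → b ∈ C := by
    rintro a b ⟨h, hb⟩
    rcases (hφN _ _ hb).1 with h' | h'
    · exact h' ▸ h.1
    · by_contra hbC
      exact h.2 ⟨h.1, b, hbC, h'⟩
  have hKQ : ∀ {q v}, v ∈ K q → v ∈ Q → v = q := by
    intro q v hv hvQ
    rcases Relation.ReflTransGen.cases_tail hv with h | ⟨w, -, h⟩
    · exact h
    · exact (hrQ h hvQ).elim
  have hKC : ∀ {q}, q ∈ Q → K q ⊆ C := by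
    intro q hq v hv
    rcases Relation.ReflTransGen.cases_tail hv with h | ⟨w, -, h⟩
    · exact h ▸ hQC hq
    · exact hrC h
  have hKK : ∀ {q q' v}, q ∈ Q → q' ∈ Q → v ∈ K q → v ∈ K q' → q = q' := by
    intro q q' v hq hq' hv hv'
    have := Relation.ReflTransGen.total_of_right_unique (r := Function.swap r)
      (fun a b c h h' => hleft h h') (Relation.reflTransGen_swap.2 hv)
      (Relation.reflTransGen_swap.2 hv')
    rcases this with h | h
    · exact hKQ (Relation.reflTransGen_swap.1 h) hq
    · exact (hKQ (Relation.reflTransGen_swap.1 h) hq').symm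
  have hexit : ∀ q ∈ Q, (∀ v ∈ K q, v ∉ innerBoundary G C) →
      ∃ i v, ∃ h, v ∈ K q ∧ φ ⟨v, h⟩ = Sum.inr i := by
    intro q hq hnb
    by_contra! hno
    have hstep : ∀ v : K q, ∃ b : K q, r v b := by
      rintro ⟨v, hv⟩
      have h : v ∈ C ∧ v ∉ innerBoundary G C := ⟨hKC hq hv, hnb v hv⟩
      rcases hb : φ ⟨v, h⟩ with b | i
      · exact ⟨⟨b, Relation.ReflTransGen.tail hv ⟨h, hb⟩⟩, h, hb⟩
      · exact (hno i v h hv hb).elim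
    choose f hf using hstep
    have hinj : Function.Injective f := fun a b hab =>
      Subtype.ext (hleft (hf a) (hab ▸ hf b))
    obtain ⟨a, ha⟩ := (Finite.injective_iff_surjective.1 hinj) ⟨q, Relation.ReflTransGen.refl⟩
    have := hf a
    rw [ha] at this
    exact hrQ this hq
  let bad : Finset V := Q.filter fun q => ∀ v ∈ K q, v ∉ innerBoundary G C
  have hbad : bad.card ≤ Q.card - n := by
    have hex : ∀ q : bad, ∃ i v, ∃ h, v ∈ K q.1 ∧ φ ⟨v, h⟩ = Sum.inr i := fun q =>
      hexit q.1 (Finset.mem_filter.1 q.2).1 (Finset.mem_filter.1 q.2).2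
    choose i v h hv hi using hex
    have hinj : Function.Injective i := by
      intro a b hab
      have h1 := hφ (((hi a).trans (congrArg Sum.inr hab)).trans (hi b).symm)
      have h2 : v a = v b := congrArg Subtype.val h1
      exact Subtype.ext (hKK (Finset.mem_filter.1 a.2).1 (Finset.mem_filter.1 b.2).1 (hv a)
        (h2 ▸ hv b))
    simpa using Fintype.card_le_of_injective i hinj
  have hQn : n ≤ Q.card := by
    refine (hn Q subset_rfl hQC).trans ?_
    rw [← Set.ncard_coe_finset]
    exact Set.ncard_le_ncard (fun x hx => hx.1) (Set.toFinite _)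
  refine ⟨Q \ bad, K, Finset.sdiff_subset, ?_, fun j hj => ?_⟩
  · rw [Finset.card_sdiff_of_subset (show bad ⊆ Q from Finset.filter_subset _ _)]
    omega
  · obtain ⟨hjQ, hjb⟩ := Finset.mem_sdiff.1 hj
    refine ⟨Relation.ReflTransGen.refl, hKC hjQ, fun v hv => ?_, fun v hv => hKQ hv, ?_, ?_⟩
    · have hv' : Relation.ReflTransGen r j v := hv
      induction hv' with
      | refl => exact .refl _
      | tail h h' ih =>
        refine (ih h).trans ?_
        obtain ⟨hw, hb⟩ := h'
        rcases (hφN _ _ hb).1 with h' | h'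
        · rw [h']; exact .refl _
        · exact .of_adj h' h hv
    · by_contra! hno
      exact hjb (Finset.mem_filter.2 ⟨hjQ, hno⟩)
    · intro i hi hij
      exact Set.disjoint_left.2 fun v hv hvj =>
        hij (hKK (Finset.mem_sdiff.1 hi).1 hjQ hv hvj)

/-! ### Fan minors -/

/-- Disjoint connected sets `K j`, each with the single vertex `j` on a path, can be extended along
the path to a model of a path. -/
theorem exists_path_model {G : SimpleGraph V} {J : Set V} {K : V → Set V}
    (hself : ∀ j ∈ J, j ∈ K j) (hconn : ∀ j ∈ J, ∀ v ∈ K j, ReachIn G (K j) j v)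
    (hdisj : ∀ j ∈ J, ∀ i ∈ J, i ≠ j → Disjoint (K i) (K j)) (l : List V) (a : V) (n : ℕ)
    (hc : (a :: l).IsChain G.Adj) (hnd : (a :: l).Nodup)
    (hK : ∀ j ∈ J, ∀ v ∈ K j, v ∈ a :: l → v = j)
    (hn : n + 1 ≤ {j ∈ J | j ∈ a :: l}.ncard) :
    ∃ B : ℕ → Set V, a ∈ B 0 ∧ (∀ i ≤ n, ∃ j ∈ J, K j ⊆ B i) ∧
      (∀ i ≤ n, ∀ v ∈ B i, v ∈ a :: l ∨ ∃ j ∈ J, j ∈ a :: l ∧ v ∈ K j) ∧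
      (∀ i ≤ n, ∃ x ∈ B i, ∀ v ∈ B i, ReachIn G (B i) x v) ∧
      (∀ i ≤ n, ∀ i' < i, Disjoint (B i') (B i)) ∧
      ∀ i < n, ∃ u ∈ B i, ∃ v ∈ B (i + 1), G.Adj u v := by
  induction l generalizing a n with
  | nil =>
    have haJ : a ∈ J ∧ n = 0 := by
      have hsub : {j ∈ J | j ∈ [a]} ⊆ {a} := fun j hj => by simpa using hj.2
      have h1 := Set.ncard_le_ncard hsub (Set.finite_singleton a)
      rw [Set.ncard_singleton] at h1
      obtain ⟨j, hj, hja⟩ := Set.nonempty_of_ncard_ne_zero (s := {j ∈ J | j ∈ [a]}) (by omega)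
      exact ⟨List.mem_singleton.1 hja ▸ hj, by omega⟩
    obtain ⟨haJ, rfl⟩ := haJ
    refine ⟨fun _ => K a, hself a haJ, fun _ _ => ⟨a, haJ, subset_rfl⟩,
      fun _ _ v hv => Or.inr ⟨a, haJ, by simp, hv⟩,
      fun _ _ => ⟨a, hself a haJ, hconn a haJ⟩, ?_, ?_⟩ <;> intros <;> omega
  | cons b l ih =>
    rw [List.isChain_cons_cons] at hc
    have hnd' := List.nodup_cons.1 hnd
    have hK' : ∀ j ∈ J, ∀ v ∈ K j, v ∈ b :: l → v = j := fun j hj v hv hvl =>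
      hK j hj v hv (List.mem_cons_of_mem _ hvl)
    have hfin : {j ∈ J | j ∈ b :: l}.Finite :=
      (b :: l).finite_toSet.subset fun j hj => hj.2
    by_cases haJ : a ∈ J
    · rcases n with _ | n
      · refine ⟨fun _ => K a, hself a haJ, fun _ _ => ⟨a, haJ, subset_rfl⟩,
          fun _ _ v hv => Or.inr ⟨a, haJ, by simp, hv⟩,
          fun _ _ => ⟨a, hself a haJ, hconn a haJ⟩, ?_, ?_⟩ <;> intros <;> omega
      · obtain ⟨B, hb, hJ, hcon, hB, hBd, hadj⟩ := ih b n hc.2 hnd'.2 hK' (by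
          have hsub : {j ∈ J | j ∈ a :: b :: l} ⊆ insert a {j ∈ J | j ∈ b :: l} := by
            rintro j ⟨hj, hjl⟩
            rcases List.mem_cons.1 hjl with h | h
            · exact Or.inl h
            · exact Or.inr ⟨hj, h⟩
          have h1 := Set.ncard_le_ncard hsub (hfin.insert a)
          have h2 := Set.ncard_insert_le a {j ∈ J | j ∈ b :: l}
          omega)
        have hdis : ∀ i ≤ n, Disjoint (K a) (B i) := by
          intro i hi
          refine Set.disjoint_left.2 fun v hv hvB => ?_
          rcases hcon i hi v hvB with h | ⟨j, hj, hjl, hvj⟩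
          · rw [hK a haJ v hv (List.mem_cons_of_mem _ h)] at h
            exact hnd'.1 h
          · refine Set.disjoint_left.1 (hdisj j hj a haJ ?_) hv hvj
            rintro rfl
            exact hnd'.1 hjl
        refine ⟨fun i => i.casesOn (K a) B, hself a haJ, ?_, ?_, ?_, ?_, ?_⟩
        · rintro (_ | i) hi
          · exact ⟨a, haJ, subset_rfl⟩
          · exact hJ i (by omega)
        · rintro (_ | i) hi v hv
          · exact Or.inr ⟨a, haJ, by simp, hv⟩
          · exact (hcon i (by omega) v hv).imp (List.mem_cons_of_mem _)
              fun ⟨j, hj, hjl, hvj⟩ => ⟨j, hj, List.mem_cons_of_mem _ hjl, hvj⟩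
        · rintro (_ | i) hi
          · exact ⟨a, hself a haJ, hconn a haJ⟩
          · exact hB i (by omega)
        · rintro (_ | i) hi (_ | i') hi'
          · omega
          · omega
          · exact hdis i (by omega)
          · exact hBd i (by omega) i' (by omega)
        · rintro (_ | i) hi
          · exact ⟨a, hself a haJ, b, hb, hc.1⟩
          · exact hadj i (by omega)
    · obtain ⟨B, hb, hJ, hcon, hB, hBd, hadj⟩ := ih b n hc.2 hnd'.2 hK' (by
        refine hn.trans (Set.ncard_le_ncard ?_ hfin)
        rintro j ⟨hj, hjl⟩
        rcases List.mem_cons.1 hjl with rfl | h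
        · exact (haJ hj).elim
        · exact ⟨hj, h⟩)
      have haB : ∀ i ≤ n, a ∉ B i := by
        intro i hi haB
        rcases hcon i hi a haB with h | ⟨j, hj, hjl, haj⟩
        · exact hnd'.1 h
        · rw [hK j hj a haj (by simp)] at haJ
          exact haJ hj
      refine ⟨fun i => i.casesOn (insert a (B 0)) fun i => B (i + 1), Set.mem_insert _ _,
        ?_, ?_, ?_, ?_, ?_⟩
      · rintro (_ | i) hi
        · obtain ⟨j, hj, hjB⟩ := hJ 0 hi
          exact ⟨j, hj, hjB.trans (Set.subset_insert _ _)⟩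
        · exact hJ (i + 1) hi
      · have hcon' : ∀ i ≤ n, ∀ v ∈ B i, v ∈ a :: b :: l ∨
            ∃ j ∈ J, j ∈ a :: b :: l ∧ v ∈ K j := fun i hi v hv =>
          (hcon i hi v hv).imp (List.mem_cons_of_mem _)
            fun ⟨j, hj, hjl, hvj⟩ => ⟨j, hj, List.mem_cons_of_mem _ hjl, hvj⟩
        rintro (_ | i) hi v hv
        · rcases hv with rfl | hv
          · exact Or.inl (by simp)
          · exact hcon' 0 hi v hv
        · exact hcon' (i + 1) hi v hv
      · rintro (_ | i) hi
        · obtain ⟨x, hx, hr⟩ := hB 0 hi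
          refine ⟨x, Or.inr hx, fun v hv => ?_⟩
          rcases hv with rfl | hv
          · exact ((hr b hb).mono (Set.subset_insert _ _)).trans
              (.of_adj hc.1.symm (Set.mem_insert_of_mem _ hb) (Set.mem_insert _ _))
          · exact (hr v hv).mono (Set.subset_insert _ _)
        · exact hB (i + 1) hi
      · rintro (_ | i) hi (_ | i') hi'
        · omega
        · omega
        · exact Set.disjoint_insert_left.2 ⟨haB _ hi, hBd _ hi 0 hi'⟩
        · exact hBd _ hi _ hi'
      · rintro (_ | i) hi
        · obtain ⟨u, hu, v, hv, huv⟩ := hadj 0 hi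
          exact ⟨u, Or.inr hu, v, hv, huv⟩
        · exact hadj (i + 1) hi

/-- A fan is spanned by a vertex and a path on the remaining vertices. -/
theorem IsFan.exists_center [Finite W] {X : SimpleGraph W} (hX : IsFan X) (hW : 0 < Nat.card W) :
    ∃ (x : W) (p : W → ℕ), (∀ w, w ≠ x → p w < Nat.card W - 1) ∧
      (∀ u v, u ≠ x → v ≠ x → p u = p v → u = v) ∧
      ∀ u v, u ≠ x → v ≠ x → X.Adj u v → p u = p v + 1 ∨ p v = p u + 1 := by
  rcases hX with ⟨n, ⟨e⟩⟩ | ⟨x, n, ⟨e⟩⟩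
  · have hn : Nat.card W = n := by simpa using Nat.card_congr e.toEquiv
    have hpos : ∀ w, w ≠ e.symm ⟨0, by omega⟩ → 0 < (e w : ℕ) := by
      intro w hw
      by_contra h0
      refine hw ?_
      rw [RelIso.eq_symm_apply]
      exact Fin.ext (by simp only; omega)
    refine ⟨e.symm ⟨0, by omega⟩, fun w => (e w : ℕ) - 1, fun w hw => ?_, fun u v hu hv h => ?_,
      fun u v hu hv h => ?_⟩
    · have := (e w).2
      have := hpos w hw
      show (e w : ℕ) - 1 < _
      omega
    · have h : (e u : ℕ) - 1 = (e v : ℕ) - 1 := h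
      have := hpos u hu
      have := hpos v hv
      exact e.injective (Fin.ext (by omega))
    · have := hpos u hu
      have := hpos v hv
      have := SimpleGraph.pathGraph_adj.1 (e.map_rel_iff.2 h)
      show (e u : ℕ) - 1 = (e v : ℕ) - 1 + 1 ∨ (e v : ℕ) - 1 = (e u : ℕ) - 1 + 1
      omega
  · classical
    have hn : Nat.card W = n + 1 := by
      have h1 : Nat.card ({x}ᶜ : Set W) = n := by simpa using Nat.card_congr e.toEquiv
      have h2 := Set.ncard_add_ncard_compl ({x} : Set W)
      rw [Set.ncard_singleton] at h2
      have h3 : Nat.card ({x}ᶜ : Set W) = ({x}ᶜ : Set W).ncard := rfl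
      omega
    refine ⟨x, fun w => if h : w ≠ x then (e ⟨w, h⟩ : ℕ) else 0, fun w hw => ?_,
      fun u v hu hv h => ?_, fun u v hu hv h => ?_⟩
    · simp only [dif_pos hw]
      have := (e ⟨w, hw⟩).2
      omega
    · simp only [dif_pos hu, dif_pos hv] at h
      exact congrArg Subtype.val (e.injective (Fin.ext h))
    · simp only [dif_pos hu, dif_pos hv]
      have h' : (X.induce ({x}ᶜ : Set W)).Adj ⟨u, hu⟩ ⟨v, hv⟩ := h
      have := SimpleGraph.pathGraph_adj.1 (e.map_rel_iff.2 h')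
      omega

/-- A connected hub together with a path model whose branch sets all touch the hub contains every
fan of the right size as a minor. -/
theorem IsFan.isMinor [Finite W] {X : SimpleGraph W} (hX : IsFan X) (hW : 0 < Nat.card W)
    {G : SimpleGraph V} {H : Set V} (hH : (G.induce H).Connected) (B : ℕ → Set V)
    (hB : ∀ i < Nat.card W - 1, (G.induce (B i)).Connected)
    (hHB : ∀ i < Nat.card W - 1, Disjoint H (B i))
    (htouch : ∀ i < Nat.card W - 1, ∃ u ∈ H, ∃ v ∈ B i, G.Adj u v)
    (hdisj : ∀ i < Nat.card W - 1, ∀ i' < i, Disjoint (B i') (B i))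
    (hadj : ∀ i, i + 1 < Nat.card W - 1 → ∃ u ∈ B i, ∃ v ∈ B (i + 1), G.Adj u v) :
    IsMinor X G := by
  classical
  obtain ⟨x, p, hp, hinj, hpadj⟩ := hX.exists_center hW
  let M : W → Set V := fun w => if w = x then H else B (p w)
  have hMx : M x = H := if_pos rfl
  have hM : ∀ {w}, w ≠ x → M w = B (p w) := fun h => if_neg h
  refine ⟨M, ⟨fun u v huv => ?_, fun w => ?_, fun u v huv => ?_⟩⟩
  · show Disjoint (M u) (M v)
    by_cases hu : u = x
    · subst hu
      rw [hMx, hM huv.symm]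
      exact hHB _ (hp v huv.symm)
    by_cases hv : v = x
    · subst hv
      rw [hMx, hM hu]
      exact (hHB _ (hp u hu)).symm
    rw [hM hu, hM hv]
    rcases lt_trichotomy (p u) (p v) with h | h | h
    · exact hdisj _ (hp v hv) _ h
    · exact (huv (hinj u v hu hv h)).elim
    · exact (hdisj _ (hp u hu) _ h).symm
  · by_cases hw : w = x
    · subst hw
      rw [hMx]
      exact hH
    · rw [hM hw]
      exact hB _ (hp w hw)
  · by_cases hu : u = x
    · subst hu
      rw [hMx, hM huv.ne']
      exact htouch _ (hp v huv.ne')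
    by_cases hv : v = x
    · subst hv
      rw [hMx, hM hu]
      obtain ⟨a, ha, b, hb, hab⟩ := htouch _ (hp u hu)
      exact ⟨b, hb, a, ha, hab.symm⟩
    rw [hM hu, hM hv]
    rcases hpadj u v hu hv huv with h | h
    · obtain ⟨a, ha, b, hb, hab⟩ := hadj (p v) (h ▸ hp u hu)
      exact ⟨b, h ▸ hb, a, ha, hab.symm⟩
    · rw [h]
      exact hadj (p u) (h ▸ hp v hv)

/-! ### Rankings of graphs without fan minors -/

/-- The connected set `H` contains all neighbours of `C` outside `C` and is adjacent to each
component of `C`. -/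
structure IsHub (G : SimpleGraph V) (C H : Set V) : Prop where
  connected : ∃ x ∈ H, ∀ v ∈ H, ReachIn G H x v
  disjoint : Disjoint C H
  nbr : ∀ a ∈ C, ∀ b ∉ C, G.Adj a b → b ∈ H
  touch : ∀ v ∈ C, ∃ r ∈ C, ReachIn G C v r ∧ ∃ h ∈ H, G.Adj r h

theorem IsHub.ncard_innerBoundary_lt [Finite V] [Finite W] {X : SimpleGraph W} (hX : IsFan X)
    (hW : 2 ≤ Nat.card W) {G : SimpleGraph V} (hG : MinorFree X G) {C H : Set V}
    (hH : IsHub G C H) {a : V} {l : List V} (hc : (a :: l).IsChain G.Adj) (hnd : (a :: l).Nodup)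
    (hC : ∀ v ∈ a :: l, v ∈ C) {A : Set V} (hA : IsTightClosure G C {v | v ∈ a :: l} A) :
    (innerBoundary G A).ncard < Nat.card W - 1 := by
  classical
  have := Fintype.ofFinite V
  by_contra! hle
  obtain ⟨m, hm⟩ : ∃ m, Nat.card W - 1 = m + 1 := ⟨Nat.card W - 2, by omega⟩
  have hQ : (((a :: l).toFinset : Finset V) : Set V) = {v | v ∈ a :: l} := by
    ext v
    simp
  obtain ⟨J, K, hJQ, hJ, hK⟩ := exists_disjoint_connections (G := G) (C := C)
    (Q := (a :: l).toFinset) (n := m + 1) (by rw [hQ]; exact hC)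
    (by rw [hQ]; exact fun B h1 h2 => hm ▸ hle.trans (hA.min B h1 h2))
  obtain ⟨B, -, hBJ, hBsub, hBconn, hBd, hBadj⟩ := exists_path_model (G := G) (J := (J : Set V))
    (K := K) (fun j hj => (hK j hj).1) (fun j hj => (hK j hj).2.2.1)
    (fun j hj => (hK j hj).2.2.2.2.2) l a m hc hnd
    (fun j hj v hv hvl => (hK j hj).2.2.2.1 v hv (List.mem_toFinset.2 hvl)) (by
      refine hJ.trans ?_
      rw [← Set.ncard_coe_finset]
      exact Set.ncard_le_ncard (fun j hj => ⟨hj, List.mem_toFinset.1 (hJQ hj)⟩) (Set.toFinite _))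
  have hBC : ∀ i ≤ m, B i ⊆ C := by
    intro i hi v hv
    rcases hBsub i hi v hv with h | ⟨j, hj, -, hvj⟩
    · exact hC v h
    · exact (hK j hj).2.1 hvj
  obtain ⟨x, hx, hxr⟩ := hH.connected
  refine hG (hX.isMinor (by omega) (connected_of_reachIn hx hxr) B ?_ ?_ ?_ ?_ ?_)
  · intro i hi
    obtain ⟨y, hy, hr⟩ := hBconn i (by omega)
    exact connected_of_reachIn hy hr
  · intro i hi
    exact (hH.disjoint.mono_left (hBC i (by omega))).symm
  · intro i hi
    obtain ⟨j, hj, hjB⟩ := hBJ i (by omega)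
    obtain ⟨v, hv, hvC, b, hb, hvb⟩ := (hK j hj).2.2.2.2.1
    exact ⟨b, hH.nbr v hvC b hb hvb, v, hjB hv, hvb.symm⟩
  · intro i hi
    exact hBd i (by omega)
  · intro i hi
    exact hBadj i (by omega)

/-- The vertices of `C` that lie on the boundary of the tight closure of one of their root paths. -/
def cutVertices (G : SimpleGraph V) (C : Set V) (Q : V → List V) (A : V → Set V) : Set V :=
  {z ∈ C | ∃ t ∈ Q z, z ∈ innerBoundary G (A t)}

section

variable {G : SimpleGraph V} {C H R : Set V} {Q : V → List V} {A : V → Set V}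

/-- Each cut vertex `z` has a topmost ancestor `t` whose tight closure has `z` on its boundary. -/
theorem exists_topmost {z : V} (hz : z ∈ cutVertices G C Q A) :
    ∃ t ∈ Q z, z ∈ innerBoundary G (A t) ∧
      ∀ x ∈ Q z, z ∈ innerBoundary G (A x) → (Q t).length ≤ (Q x).length := by
  obtain ⟨t, ⟨ht, htz⟩, hmin⟩ := Set.exists_min_image
    {t | t ∈ Q z ∧ z ∈ innerBoundary G (A t)} (fun t => (Q t).length)
    ((Q z).finite_toSet.subset fun t ht => ht.1) hz.2
  exact ⟨t, ht, htz, fun x hx hxz => hmin x ⟨hx, hxz⟩⟩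

/-- A vertex reached from the cut vertex `u` without passing through a cut vertex of smaller depth
is a descendant of the topmost vertex `t` for `u`. -/
theorem mem_path_of_reachIn [Finite V] (hQ : IsNormalForest G C R Q)
    (hA : ∀ t ∈ C, IsTightClosure G C {w | w ∈ Q t} (A t)) {d : V → ℕ}
    (hd : ∀ z ∈ cutVertices G C Q A, ∀ x ∈ Q z, z ∈ innerBoundary G (A x) → d z ≤ (Q x).length)
    {u t v : V} (hu : u ∈ C) (ht : t ∈ Q u) (hut : u ∈ innerBoundary G (A t))
    (hdt : (Q t).length ≤ d u)
    (hr : ReachIn G {w ∈ C | w ∈ cutVertices G C Q A → d u ≤ d w} u v) : t ∈ Q v := by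
  have htC := hQ.mem u hu t ht
  have hself : ∀ {x}, x ∈ C → x ∈ A x := fun hx => (hA _ hx).subset (hQ.self_mem hx)
  have huU : u ∈ cutVertices G C Q A := ⟨hu, t, ht, hut⟩
  refine (hr.induct (p := fun v => t ∈ Q v ∧ ∀ x ∈ Q t, x ≠ t → v ∉ A x) ⟨ht, ?_⟩ ?_).1
  · intro x hx hxt hux
    have hxC := hQ.mem t htC x hx
    have hsub : A x ⊆ A t := (hA x hxC).mono (hA t htC) fun w hw => hQ.trans htC hw hx
    refine hxt (hQ.eq_of_length_le htC hx (hdt.trans ?_))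
    exact hd u huU x (hQ.trans hu hx ht) (innerBoundary_of_subset hsub hut hux)
  · rintro a b hab ⟨haC, -⟩ ⟨hbC, hbd⟩ ⟨hta, hno⟩
    have hcontra : ∀ x ∈ Q t, x ≠ t → x ∈ Q b → b ∉ A x := by
      intro x hx hxt hxb hbx
      have hb : b ∈ innerBoundary G (A x) := ⟨hbx, a, hno x hx hxt, hab.symm⟩
      have hbU : b ∈ cutVertices G C Q A := ⟨hbC, x, hxb, hb⟩
      exact hxt (hQ.eq_of_length_le htC hx
        (hdt.trans ((hbd hbU).trans (hd b hbU x hxb hb))))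
    have htb : t ∈ Q b := by
      rcases hQ.adj a haC b hbC hab with h | h
      · exact hQ.trans hbC hta h
      · rcases hQ.total haC hta h with h' | h'
        · exact h'
        · by_cases hbt : b = t
          · exact hbt ▸ hQ.self_mem hbC
          · exact (hcontra b h' hbt (hQ.self_mem hbC) (hself hbC)).elim
    exact ⟨htb, fun x hx hxt => hcontra x hx hxt (hQ.trans hbC hx htb)⟩

/-- The complement of a component of the non-cut vertices of `C` is connected to the hub. -/
theorem reachIn_hub_of_component [Finite V] (hH : IsHub G C H)
    (hQ : IsNormalForest G C {r | ∃ h ∈ H, G.Adj r h} Q)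
    (hA : ∀ t ∈ C, IsTightClosure G C {w | w ∈ Q t} (A t)) {D : Set V}
    (hDC : D ⊆ C \ cutVertices G C Q A)
    (hDmax : ∀ a ∈ D, ∀ b ∈ C \ cutVertices G C Q A, G.Adj a b → b ∈ D)
    {c : V} (hc : c ∈ D) (hconn : ∀ v ∈ D, ReachIn G D c v) (hleast : ∀ v ∈ D, c ∈ Q v)
    {v : V} (hv : v ∈ C \ D) : ∃ h ∈ H, ReachIn G (H ∪ (C \ D)) v h := by
  by_contra! hno
  let E : Set V := {e | ReachIn G (H ∪ (C \ D)) v e}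
  have hcC := (hDC hc).1
  have hEC : ∀ e ∈ E, e ∈ C ∧ e ∉ D := by
    intro e he
    rcases ReachIn.mem_right he (Or.inr hv) with h | h
    · exact (hno e h he).elim
    · exact h
  have hEnbr : ∀ e ∈ E, ∀ b, G.Adj e b → b ∈ E ∨ b ∈ D := by
    intro e he b heb
    by_cases hbD : b ∈ D
    · exact Or.inr hbD
    · left
      have hb : b ∈ H ∪ (C \ D) := by
        by_cases hbC : b ∈ C
        · exact Or.inr ⟨hbC, hbD⟩
        · exact Or.inl (hH.nbr e (hEC e he).1 b hbC heb)
      exact ReachIn.trans he (.of_adj heb (Or.inr (hEC e he)) hb)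
  have hED : ∀ e ∈ E, ∃ b ∈ D, b ∈ Q e := by
    intro e he
    by_contra! hnoD
    have heC := (hEC e he).1
    obtain ⟨r, ⟨h, hhH, hrh⟩, hl⟩ := hQ.last e heC
    have hrQ := List.mem_of_getLast? hl
    have hmem : ∀ w ∈ Q e, w ∈ H ∪ (C \ D) := fun w hw =>
      Or.inr ⟨hQ.mem e heC w hw, fun hwD => hnoD w hwD hw⟩
    exact hno h hhH <| ReachIn.trans he <|
      ((hQ.reachIn heC hrQ).mono hmem).trans (.of_adj hrh (hmem r hrQ) (Or.inl hhH))
  have hEc : ∀ e ∈ E, c ∈ Q e := by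
    intro e he
    obtain ⟨b, hb, hbe⟩ := hED e he
    exact hQ.trans (hEC e he).1 (hleast b hb) hbe
  obtain ⟨z, hzE, b, hbD, hzb⟩ : ∃ z ∈ E, ∃ b ∈ D, G.Adj z b := by
    by_contra! hnone
    have hvE : v ∈ E := ReachIn.refl v
    obtain ⟨b, hb, hbv⟩ := hED v hvE
    have hbE : b ∈ E := (hQ.reachIn hv.1 hbv).induct (p := fun w => w ∈ E) hvE
      fun x y hxy _ _ hx => (hEnbr x hx y hxy).resolve_right fun hy => hnone x hx y hy hxy
    exact (hEC b hbE).2 hb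
  have hzU : z ∈ cutVertices G C Q A := by
    by_contra h
    exact (hEC z hzE).2 (hDmax b hbD z ⟨(hEC z hzE).1, h⟩ hzb.symm)
  -- A closure `A t` with `t` above `D` contains all of `D` or none of it.
  have hall : ∀ t ∈ Q c, ∀ y ∈ D, y ∈ A t → D ⊆ A t := by
    intro t ht y hy hyA w hw
    refine ((hconn y hy).symm.trans (hconn w hw)).induct (p := fun w => w ∈ A t) hyA ?_
    intro p q hpq hp _ hpA
    by_contra hqA
    exact (hDC hp).2 ⟨(hDC hp).1, t, hQ.trans (hDC hp).1 ht (hleast p hp), hpA, q, hqA, hpq⟩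
  have hfull : ∀ t ∈ Q c, D ⊆ A t → z ∈ A t ∧ z ∉ innerBoundary G (A t) := by
    intro t ht hD
    have htC := hQ.mem c hcC t ht
    have hE : E ⊆ A t := by
      refine Set.subset_union_right.trans ((hA t htC).max (A t ∪ E)
        ((hA t htC).subset.trans Set.subset_union_left)
        (Set.union_subset (hA t htC).subset_univ fun e he => (hEC e he).1)
        (Set.ncard_le_ncard ?_ (Set.toFinite _)))
      rintro p ⟨hp, q, hq, hpq⟩
      rcases hp with hp | hp
      · exact ⟨hp, q, fun h => hq (Or.inl h), hpq⟩
      · rcases hEnbr p hp q hpq with h | h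
        · exact (hq (Or.inr h)).elim
        · exact (hq (Or.inl (hD h))).elim
    refine ⟨hE hzE, ?_⟩
    rintro ⟨-, q, hq, hzq⟩
    exact (hEnbr z hzE q hzq).elim (fun h => hq (hE h)) fun h => hq (hD h)
  obtain ⟨t, htc, htz⟩ : ∃ t ∈ Q c, z ∈ innerBoundary G (A t) := by
    obtain ⟨hzC, t, ht, htz⟩ := hzU
    rcases hQ.total hzC ht (hEc z hzE) with h | h
    · exact ⟨t, h, htz⟩
    · refine ⟨c, hQ.self_mem hcC, ?_⟩
      have htC := hQ.mem z hzC t ht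
      have hsub : A c ⊆ A t := (hA c hcC).mono (hA t htC) fun w hw => hQ.trans htC hw h
      have hcA : c ∈ A c := (hA c hcC).subset (hQ.self_mem hcC)
      exact innerBoundary_of_subset hsub htz
        (hfull c (hQ.self_mem hcC) (hall c (hQ.self_mem hcC) c hc hcA)).1
  have htC := hQ.mem c hcC t htc
  by_cases hDA : ∃ y ∈ D, y ∈ A t
  · obtain ⟨y, hy, hyA⟩ := hDA
    exact (hfull t htc (hall t htc y hy hyA)).2 htz
  · push Not at hDA
    have hlt : (innerBoundary G (A t \ E)).ncard < (innerBoundary G (A t)).ncard := by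
      refine Set.ncard_lt_ncard ⟨?_, fun h => (h htz).1.2 hzE⟩ (Set.toFinite _)
      rintro p ⟨⟨hp, hpE⟩, q, hq, hpq⟩
      refine ⟨hp, q, fun hqA => ?_, hpq⟩
      have hqE : q ∈ E := by
        by_contra h
        exact hq ⟨hqA, h⟩
      rcases hEnbr q hqE p hpq.symm with h | h
      · exact hpE h
      · exact hDA p h hp
    refine absurd hlt (not_lt.2 ((hA t htC).min _ (fun w hw => ⟨(hA t htC).subset hw, ?_⟩)
      (Set.sdiff_subset.trans (hA t htC).subset_univ)))
    intro hwE
    have hcw := hEc w hwE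
    have hwc : w ∈ Q c := hQ.trans hcC hw htc
    exact (hEC w hwE).2 (hQ.antisymm hcC hwc hcw ▸ hc)

end

theorem hasRanking_of_isHub [Finite V] [Finite W] {X : SimpleGraph W} (hX : IsFan X)
    (hW : 2 ≤ Nat.card W) {G : SimpleGraph V} (hG : MinorFree X G) (n : ℕ) (C H : Set V)
    (hn : C.ncard = n) (hH : IsHub G C H) : HasRanking G ((Nat.card W - 1).choose 2) C := by
  classical
  induction n using Nat.strong_induction_on generalizing C H with
  | _ n ih =>
  obtain ⟨Q, hQ⟩ := exists_isNormalForest G _ C {r | ∃ h ∈ H, G.Adj r h} rfl fun v hv => by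
    obtain ⟨r, hr, hvr, h⟩ := hH.touch v hv
    exact ⟨r, h, hr, hvr⟩
  have hex : ∀ t, ∃ A, t ∈ C → IsTightClosure G C {w | w ∈ Q t} A := by
    intro t
    by_cases ht : t ∈ C
    · obtain ⟨A, hA⟩ := exists_isTightClosure G (Q := {w | w ∈ Q t}) (hQ.mem t ht)
      exact ⟨A, fun _ => hA⟩
    · exact ⟨∅, fun h => (ht h).elim⟩
  choose A hA using hex
  have hdex : ∀ z, ∃ d : ℕ, z ∈ cutVertices G C Q A → ∃ t ∈ Q z, z ∈ innerBoundary G (A t) ∧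
      (Q t).length = d ∧ ∀ x ∈ Q z, z ∈ innerBoundary G (A x) → d ≤ (Q x).length := by
    intro z
    by_cases hz : z ∈ cutVertices G C Q A
    · obtain ⟨t, ht, htz, hmin⟩ := exists_topmost hz
      exact ⟨_, fun _ => ⟨t, ht, htz, rfl, hmin⟩⟩
    · exact ⟨0, fun h => (hz h).elim⟩
  choose d hd using hdex
  refine hasRanking_of_components (U := cutVertices G C Q A) d ?_ ?_ ?_
  · intro u hu b hb hub
    exact ⟨hu, u, hQ.self_mem hu, (hA u hu).subset (hQ.self_mem hu), b,
      fun h => hb ((hA u hu).subset_univ h), hub⟩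
  · intro v hv
    refine (Set.ncard_le_ncard (t := ⋃ t ∈ {t | t ∈ Q v}, innerBoundary G (A t)) ?_
      (Set.toFinite _)).trans (ncard_iUnion_le_choose _ _ _ ?_ ?_)
    · rintro u ⟨huU, hr⟩
      obtain ⟨t, ht, htu, hdt, -⟩ := hd u huU
      refine Set.mem_biUnion (x := t) ?_ htu
      exact mem_path_of_reachIn hQ hA (fun z hz => (hd z hz).choose_spec.2.2.2) huU.1 ht htu
        hdt.le hr
    · intro t ht
      have htC := hQ.mem v hv t ht
      obtain ⟨l, hl⟩ := hQ.head t htC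
      have h1 := hQ.chain t htC
      have h2 := hQ.nodup t htC
      have h3 := hQ.mem t htC
      have h4 := hA t htC
      rw [hl] at h1 h2 h3 h4
      exact hH.ncard_innerBoundary_lt hX hW hG h1 h2 h3 h4
    · intro t ht t' ht' he
      have htC := hQ.mem v hv t ht
      have htC' := hQ.mem v hv t' ht'
      rcases hQ.total hv ht ht' with h | h
      · rw [(hA t htC).eq_of_ncard_eq (hA t' htC') (fun w hw => hQ.trans htC' hw h) he]
      · rw [(hA t' htC').eq_of_ncard_eq (hA t htC) (fun w hw => hQ.trans htC hw h) he.symm]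
  · intro w hw
    set D : Set V := {v | ReachIn G (C \ cutVertices G C Q A) w v}
    have hDC : D ⊆ C \ cutVertices G C Q A := fun v hv => ReachIn.mem_right hv hw
    have hDmax : ∀ a ∈ D, ∀ b ∈ C \ cutVertices G C Q A, G.Adj a b → b ∈ D :=
      fun a ha b hb hab => ReachIn.trans ha (.of_adj hab (hDC ha) hb)
    have hwD : w ∈ D := ReachIn.refl w
    have hDconn : ∀ v ∈ D, ReachIn G D w v := fun v hv =>
      (ReachIn.restrict hv hwD fun a b hab _ hb ha => hDmax a ha b hb hab).2
    obtain ⟨c, hc, hleast⟩ := hQ.exists_least (fun v hv => (hDC hv).1) hwD hDconn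
    have hcconn : ∀ v ∈ D, ReachIn G D c v := fun v hv => (hDconn c hc).symm.trans (hDconn v hv)
    have hhub := fun v hv =>
      reachIn_hub_of_component hH hQ hA hDC hDmax hc hcconn hleast (v := v) hv
    have hcC := (hDC hc).1
    obtain ⟨l, hl⟩ := hQ.head c hcC
    have hnd := hQ.nodup c hcC
    rw [hl, List.nodup_cons] at hnd
    -- The least vertex of `D` is adjacent to its parent or, if it is a root, to the hub.
    have htouch : ∃ h ∈ H ∪ (C \ D), G.Adj c h := by
      rcases l with _ | ⟨p, l⟩
      · obtain ⟨r, ⟨h, hh, hrh⟩, hr⟩ := hQ.last c hcC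
        rw [hl, List.getLast?_singleton, Option.some.injEq] at hr
        exact ⟨h, Or.inl hh, hr ▸ hrh⟩
      · have hpQ : p ∈ Q c := by simp [hl]
        have hch := hQ.chain c hcC
        rw [hl, List.isChain_cons_cons] at hch
        refine ⟨p, Or.inr ⟨hQ.mem c hcC p hpQ, fun hpD => ?_⟩, hch.1⟩
        exact hch.1.ne (hQ.antisymm hcC hpQ (hleast p hpD)).symm
    have hUne : ∃ u ∈ C, u ∉ D := by
      obtain ⟨r, ⟨h, hh, hrh⟩, hr⟩ := hQ.last c hcC
      have hrC := hQ.mem c hcC r (List.mem_of_getLast? hr)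
      refine ⟨r, hrC, fun hrD => (hDC hrD).2 ⟨hrC, r, hQ.self_mem hrC, ?_⟩⟩
      exact ⟨(hA r hrC).subset (hQ.self_mem hrC), h,
        fun h' => Set.disjoint_left.1 hH.disjoint ((hA r hrC).subset_univ h') hh, hrh⟩
    refine ih D.ncard ?_ D (H ∪ (C \ D)) rfl ⟨?_, ?_, ?_, ?_⟩
    · rw [← hn]
      obtain ⟨u, huC, huD⟩ := hUne
      exact Set.ncard_lt_ncard ⟨fun v hv => (hDC hv).1, fun h => huD (h huC)⟩ (Set.toFinite _)
    · obtain ⟨x, hx, hxr⟩ := hH.connected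
      refine ⟨x, Or.inl hx, ?_⟩
      rintro v (hv | hv)
      · exact (hxr v hv).mono Set.subset_union_left
      · obtain ⟨h, hh, hr⟩ := hhub v hv
        exact ((hxr h hh).mono Set.subset_union_left).trans hr.symm
    · refine Set.disjoint_left.2 fun v hv hv' => ?_
      rcases hv' with h | h
      · exact Set.disjoint_left.1 hH.disjoint (hDC hv).1 h
      · exact h.2 hv
    · intro a ha b hb hab
      by_cases hbC : b ∈ C
      · exact Or.inr ⟨hbC, hb⟩
      · exact Or.inl (hH.nbr a (hDC ha).1 b hbC hab)
    · exact fun v hv => ⟨c, hc, (hcconn v hv).symm, htouch⟩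

end LayeredTreedepth

theorem theorem2 {V W : Type*} [Finite V] [Finite W] (X : SimpleGraph W)
    (hX : LayeredTreedepth.IsFan X) (hcard : 3 ≤ Nat.card W)
    (G : SimpleGraph V) (hG : LayeredTreedepth.MinorFree X G) :
    LayeredTreedepth.ltd G ≤ ((Nat.card W - 1).choose 2 : ℕ) := by
  open LayeredTreedepth in
  let rep : V → V := fun v => (G.connectedComponentMk v).out
  have hrep : ∀ v, ReachIn G Set.univ (rep v) v := fun v =>
    .of_reachable (SimpleGraph.ConnectedComponent.exact (Quot.out_eq (G.connectedComponentMk v)))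
  have hrep_eq : ∀ {u v}, ReachIn G Set.univ u v → rep u = rep v := by
    intro u v h
    refine h.induct (p := fun v => rep u = rep v) rfl fun a b hab _ _ ha => ha.trans ?_
    simp only [rep, SimpleGraph.ConnectedComponent.sound hab.reachable]
  have hrank : HasRanking G ((Nat.card W - 1).choose 2) Set.univ := by
    refine hasRanking_of_components (U := Set.range rep) (fun _ => 0)
      (fun u _ b hb => (hb trivial).elim) ?_ ?_
    · intro v _
      have h1 : 1 ≤ (Nat.card W - 1).choose 2 := Nat.choose_pos (by omega)
      refine (Set.ncard_le_ncard (t := {rep v}) ?_ (Set.toFinite _)).trans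
        ((Set.ncard_singleton _).trans_le h1)
      rintro u ⟨⟨x, rfl⟩, hr⟩
      exact (hrep_eq (hrep x)).symm.trans (hrep_eq (hr.mono (Set.subset_univ _)))
    · intro w hw
      set D : Set V := {v | ReachIn G (Set.univ \ Set.range rep) w v}
      have hDU : ∀ v ∈ D, v ∉ Set.range rep := fun v hv => (ReachIn.mem_right hv hw).2
      have hDmax : ∀ a ∈ D, ∀ b, G.Adj a b → b ∉ Set.range rep → b ∈ D := fun a ha b hab hb =>
        ReachIn.trans ha (.of_adj hab ⟨trivial, hDU a ha⟩ ⟨trivial, hb⟩)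
      have hwD : w ∈ D := ReachIn.refl w
      have hDconn : ∀ v ∈ D, ReachIn G D w v := fun v hv =>
        (ReachIn.restrict hv hwD fun a b hab _ hb ha => hDmax a ha b hab hb.2).2
      have hnbr : ∀ a ∈ D, ∀ b ∉ D, G.Adj a b → b = rep w := by
        intro a ha b hb hab
        obtain ⟨y, hy⟩ : b ∈ Set.range rep := by
          by_contra h
          exact hb (hDmax a ha b hab h)
        have hwb : ReachIn G Set.univ w b :=
          ((hDconn a ha).mono (Set.subset_univ _)).trans (.of_adj hab trivial trivial)
        rw [hrep_eq hwb, ← hy]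
        exact (hrep_eq (hrep y)).symm
      have htouch : ∃ a ∈ D, G.Adj a (rep w) := by
        by_contra! hno
        refine hDU (rep w) ?_ ⟨w, rfl⟩
        refine (hrep w).symm.induct (p := fun v => v ∈ D) hwD fun a b hab _ _ ha => ?_
        by_contra hb
        exact hno a ha (hnbr a ha b hb hab ▸ hab)
      refine hasRanking_of_isHub hX (by omega) hG _ D {rep w} rfl ⟨?_, ?_, hnbr, ?_⟩
      · exact ⟨rep w, rfl, fun v hv => hv ▸ .refl _⟩
      · exact Set.disjoint_singleton_right.2 fun h => hDU _ h ⟨w, rfl⟩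
      · obtain ⟨a, ha, haw⟩ := htouch
        exact fun v hv => ⟨a, ha, (hDconn v hv).symm.trans (hDconn a ha), rep w, rfl, haw⟩
  obtain ⟨ρ, L, hL, -, hk⟩ := hrank
  refine ltd_le_of_ranking G ρ L _ (fun u v => hL u trivial v trivial) fun v i => ?_
  simpa [Precedes] using hk v trivial i
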